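/- Let $(W,S)$ be a Coxeter system of finite rank $|S|\ge 1$, with length function $\ell$. Let $\le_R$ be the right weak order on $W$ (the reflexive transitive closure of the relation "$\ell(x)<\ell(y)$ and $x^{-1}y\in S$"), and $[u,v]_R=\{w\in W: u\le_R w\le_R v\}$. For $s\in S$ and $w\in W$ put $J=S\setminus\{s\}$ and let $P^{(s)}(w)$ be the element $x$ of the unique factorization $w=xy$ with $\ell(xr)>\ell(x)$ for all $r\in J$, $y\in W_J=\langle J\rangle$, and $\ell(w)=\ell(x)+\ell(y)$. Put $P(w)=\{(P^{(s)}(w),s): s\in S\}\subseteq W\times S$. For $Y\subseteq W$, the Coxeter complex of $Y$ is the simplicial complex on $W\times S$ whose faces are the nonempty subsets of the sets $P(y)$, $y\in Y$. For $n,k\in\mathbb N$ let $[n]^k_<$ be the set of strictly increasing $k$-tuples in $[n]=\{1,\dots,n\}$, ordered componentwise (the Bruhat or Gale order) and identified with the set of $k$-element subsets of $[n]$. A sequence $(C_1,\dots,C_h)$ of distinct elements of $[n]^k_<$ is a shelling order if for all $i<j$ there are $r<j$, $a\in C_j\setminus C_i$ and $b\in C_r\setminus C_j$ such that $C_r$ is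 the symmetric difference of $C_j$ and $\{a,b\}$. A pure simplicial complex $X$ of dimension $d\ge 0$ with vertex set $V(X)$ of size $n\ge 1$ is linearly shellable if there is a bijection $\sigma:V(X)\to[n]$ such that the set $\{\sigma(F): F \text{ a facet of } X\}\subseteq[n]^{d+1}_<$, with the induced order, has a linear extension which is a shelling order. Theorem. Let $u,v\in W$ with $u\le_R v$, and let $C(u,v)$ be the Coxeter complex of $[u,v]_R$. Then the set of facets of $C(u,v)$ is $\{P(w): w\in[u,v]_R\}$, the complex $C(u,v)$ is pure of dimension $|S|-1$, and $C(u,v)$ is linearly shellable. -/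

import Mathlib

/-! ### Pure simplicial complexes, the Gale order and linear shellability -/

/-- The set `[n]^k_<` of strictly increasing `k`-tuples in `[n]` (here `[n]` is `Fin n`). As a
subtype of `Fin k → Fin n` it carries the componentwise order, i.e. the Bruhat (Gale) order. -/
abbrev IncTuple (n k : ℕ) : Type := {x : Fin k → Fin n // StrictMono x}

/-- The `k`-subset of `[n]` identified with an element of `[n]^k_<`. -/
def IncTuple.toSet {n k : ℕ} (x : IncTuple n k) : Set (Fin n) := Set.range x.1

/-- A sequence `C₁, …, C_h` of pairwise distinct elements of `[n]^k_<` is a shelling order if for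
all `i < j` there is `r < j` with `C_r = C_j + {a, b}` (symmetric difference), where
`a ∈ C_j \ C_i` and `b ∈ C_r \ C_j`. -/
def IsShellingOrder {n k h : ℕ} (C : Fin h → IncTuple n k) : Prop :=
  Function.Injective C ∧
    ∀ i j : Fin h, i < j → ∃ r : Fin h, r < j ∧
      ∃ a ∈ (C j).toSet \ (C i).toSet, ∃ b ∈ (C r).toSet \ (C j).toSet,
        (C r).toSet = symmDiff (C j).toSet {a, b}

/-- A linear extension of a poset with `h` elements: a bijection `L : P → [h]` such that
`x < y` implies `L x < L y`. The corresponding sequence of elements of `P` is `L.symm`. -/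
def IsLinearExtension {P : Type*} [PartialOrder P] {h : ℕ} (L : P ≃ Fin h) : Prop :=
  ∀ x y : P, x < y → L x < L y

namespace PreAbstractSimplicialComplex

variable {ι : Type*}

/-- The set `V(X)` of vertices. -/
def vertices (X : PreAbstractSimplicialComplex ι) : Set ι := {v | {v} ∈ X.faces}

/-- The facets: the faces which are maximal with respect to inclusion. -/
def facets (X : PreAbstractSimplicialComplex ι) : Set (Finset ι) :=
  {F | Maximal (fun G => G ∈ X.faces) F}

/-- Pure of dimension `d`: all facets have cardinality `d + 1`. -/
def IsPure (X : PreAbstractSimplicialComplex ι) (d : ℕ) : Prop :=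
  ∀ F ∈ X.facets, F.card = d + 1

theorem mem_vertices_of_mem_facet (X : PreAbstractSimplicialComplex ι) {F : Finset ι}
    (hF : F ∈ X.facets) {v : ι} (hv : v ∈ F) : v ∈ X.vertices :=
  (X.isRelLowerSet_faces hF.1).2 (Finset.singleton_subset_iff.2 hv) (Finset.singleton_nonempty v)

/-- The set of labels of the vertices of a facet, for a labeling `σ : V(X) → [n]`. -/
def labels (X : PreAbstractSimplicialComplex ι) {n : ℕ} (σ : X.vertices ≃ Fin n)
    (F : X.facets) : Finset (Fin n) :=
  F.1.attach.map
    ⟨fun v : {x // x ∈ F.1} => σ ⟨v.1, X.mem_vertices_of_mem_facet F.2 v.2⟩,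
      fun _ _ h => Subtype.ext (congrArg (fun z : X.vertices => z.1) (σ.injective h))⟩

theorem card_labels (X : PreAbstractSimplicialComplex ι) {n d : ℕ} (hX : X.IsPure d)
    (σ : X.vertices ≃ Fin n) (F : X.facets) : (X.labels σ F).card = d + 1 := by
  rw [labels, Finset.card_map, Finset.card_attach, hX F.1 F.2]

/-- The map `σ_X` from the facets of `X` to `[n]^{d+1}_<` induced by a labeling `σ`: a facet is sent
to the increasing tuple of the labels of its vertices. -/
def inducedMap (X : PreAbstractSimplicialComplex ι) {n d : ℕ} (hX : X.IsPure d)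
    (σ : X.vertices ≃ Fin n) (F : X.facets) : IncTuple n (d + 1) :=
  ⟨(X.labels σ F).orderEmbOfFin (X.card_labels hX σ F), OrderEmbedding.strictMono _⟩

/-- `X` is a pure simplicial complex of some dimension `d` with `n ≥ 1` vertices which is linearly
shellable: for some bijective labeling `σ : V(X) → [n]` of the vertices, the image of `σ_X`, with
the order induced by the Bruhat (Gale) order of `[n]^{d+1}_<`, has a linear extension which is a
shelling order. -/
def LinearlyShellable (X : PreAbstractSimplicialComplex ι) : Prop :=
  ∃ (d n : ℕ) (_ : n ≠ 0) (hX : X.IsPure d) (σ : X.vertices ≃ Fin n)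
    (h : ℕ) (L : Set.range (X.inducedMap hX σ) ≃ Fin h),
      IsLinearExtension L ∧ IsShellingOrder (fun i : Fin h => (L.symm i).1)

end PreAbstractSimplicialComplex

/-! ### The Coxeter complex -/

namespace CoxeterSystem

variable {B W : Type*} [Group W] {M : CoxeterMatrix B} (cs : CoxeterSystem M W)

/-- The right weak order: the reflexive transitive closure of the relation
"`ℓ(x) < ℓ(y)` and `x⁻¹ y ∈ S`". -/
def RightWeakLE (u v : W) : Prop :=
  Relation.ReflTransGen
    (fun x y => cs.length x < cs.length y ∧ x⁻¹ * y ∈ Set.range cs.simple) u v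

/-- The interval `[u, v]_R` of the right weak order. -/
def rightWeakInterval (u v : W) : Set W :=
  {w | cs.RightWeakLE u w ∧ cs.RightWeakLE w v}

/-- The parabolic subgroup `W_J`. -/
def parabolic (J : Set B) : Subgroup W := Subgroup.closure (cs.simple '' J)

/-- The set `W^J` of those `w` with `ℓ(w) < ℓ(ws)` for all `s ∈ J`. -/
def parabolicQuotient (J : Set B) : Set W :=
  {w | ∀ s ∈ J, cs.length w < cs.length (w * cs.simple s)}

theorem exists_parabolic_factorization (J : Set B) (w : W) :
    ∃ x : W, x ∈ cs.parabolicQuotient J ∧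
      ∃ y ∈ cs.parabolic J, w = x * y ∧ cs.length w = cs.length x + cs.length y := by
  induction hn : cs.length w using Nat.strong_induction_on generalizing w with
  | _ n ih =>
    by_cases hw : w ∈ cs.parabolicQuotient J
    · exact ⟨w, hw, 1, Subgroup.one_mem _, by simp, by simp [hn]⟩
    · simp only [parabolicQuotient, Set.mem_ofPred_eq, not_forall, not_lt] at hw
      obtain ⟨s, hs, hle⟩ := hw
      have hlen : cs.length (w * cs.simple s) + 1 = cs.length w := by
        rcases cs.length_mul_simple w s with h | h <;> omega
      obtain ⟨x, hx, y, hy, hxy, hl⟩ := ih (cs.length (w * cs.simple s)) (by omega) _ rfl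
      have hwxy : w = x * (y * cs.simple s) := by
        rw [← mul_assoc, ← hxy, cs.simple_mul_simple_cancel_right]
      refine ⟨x, hx, y * cs.simple s,
        mul_mem hy (Subgroup.subset_closure ⟨s, hs, rfl⟩), hwxy, ?_⟩
      have h1 := cs.length_mul_le x (y * cs.simple s)
      rw [← hwxy] at h1
      have h2 := cs.length_mul_le y (cs.simple s)
      rw [cs.length_simple] at h2
      omega

/-- The projection `P^J : W → W`, `w ↦ w^J`, where `w = w^J w_J` is the (unique) factorization with
`w^J ∈ W^J`, `w_J ∈ W_J` and `ℓ(w) = ℓ(w^J) + ℓ(w_J)`. -/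
noncomputable def proj (J : Set B) (w : W) : W :=
  (cs.exists_parabolic_factorization J w).choose

variable [Fintype B]

/-- `P(w) = {(P^{(s)}(w), s) : s ∈ S}`, where `P^{(s)} = P^{S \ {s}}`. The generating set `S` is
indexed by `B`. -/
noncomputable def coxeterFacet (w : W) : Finset (W × B) :=
  Finset.univ.map ⟨fun s : B => (cs.proj {s}ᶜ w, s), fun _ _ h => congrArg Prod.snd h⟩

/-- The Coxeter complex of `Y ⊆ W`: the simplicial complex on `W × S` generated by the sets `P(y)`,
`y ∈ Y`. -/
def coxeterComplex (Y : Set W) : PreAbstractSimplicialComplex (W × B) where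
  faces := {F | F.Nonempty ∧ ∃ y ∈ Y, F ⊆ cs.coxeterFacet y}
  isRelLowerSet_faces := fun _ hF =>
    ⟨hF.1, fun _ hGF hG => ⟨hG, hF.2.imp fun _ hy => ⟨hy.1, Finset.Subset.trans hGF hy.2⟩⟩⟩

end CoxeterSystem

/-!
The vertices are labelled so that longer elements get larger labels, and then every linear extension
of the Gale order on the facets is a shelling order. Three facts about a Coxeter group are behind
this.

*Going up.* If `w < w s_i` in the right weak order, then `P(w)` and `P(w s_i)` differ in the vertex of
type `i` only, and this vertex gets longer (`CoxeterSystem.length_proj_lt`). Hence `P` is monotone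
from the right weak order to the Gale order (`CoxeterSystem.inducedMap_toFacet_mono`).

*Going down.* Let `P(x)` come before `P(y)` in a linear extension, so that `y ≤ x` fails in the right
weak order. The shelling condition holds with `P(y s_i)` in the place of `C_r`, provided that `y s_i`
is below `y`, lies in the interval, and `x`, `y` have different vertices of type `i`. Suppose that no
`i` is like that, and let `D` be the set of all `i` with `u ≤ y s_i < y`. Then `y⁻¹ x` lies in
`W_{S ∖ {i}}` for all `i ∈ D`, hence in `W_{S ∖ D}` (`CoxeterSystem.mem_parabolic_of_forall`).

*Least elements.* The elements above `u` in the coset `y W_{S ∖ D}` have a least element, the element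
of the coset nearest to `u` (`CoxeterSystem.exists_forall_rightWeakLE_iff`). By the choice of `D` one
cannot go down from `y` within the coset while staying above `u`, so `y` is this least element and
`y ≤ x`, a contradiction (`CoxeterSystem.exists_mul_simple_proj_ne`).

The theory of cosets of parabolic subgroups used here rests on the exchange property
(`CoxeterSystem.exchange_mul`), obtained from the action of `W` on signed elements, and on the fact
that `s_i ∈ W_J` only if `i ∈ J` (`CoxeterSystem.simple_mem_parabolic_iff`), obtained from the
geometric representation.
-/

/-! ### The inversion cocycle and the exchange property -/

namespace CoxeterSystem

variable {B W : Type*} [Group W] {M : CoxeterMatrix B} (cs : CoxeterSystem M W)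

open scoped Classical in
/-- The action of the simple reflection `i` on `W × ZMod 2`: conjugation on the first coordinate,
with a change of the second one exactly at the element `s_i`. -/
noncomputable def signedConj (i : B) : Function.End (W × ZMod 2) := fun p =>
  (cs.simple i * p.1 * cs.simple i, p.2 + if p.1 = cs.simple i then 1 else 0)

open scoped Classical in
/-- The `k`-th power of the action of `s_i s_j` changes the sign of `t` once for each occurrence of
`t` in the inversion sequence `s_j (s_i s_j) ^ l`, `l < 2 * k`, of the alternating word. -/
theorem signedConj_mul_pow (i j : B) (k : ℕ) (t : W) (e : ZMod 2) :
    ((cs.signedConj i * cs.signedConj j) ^ k) (t, e) =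
      ((cs.simple i * cs.simple j) ^ k * t * ((cs.simple i * cs.simple j) ^ k)⁻¹,
        e + ∑ l ∈ Finset.range (2 * k),
          if t = cs.simple j * (cs.simple i * cs.simple j) ^ l then 1 else 0) := by
  set p := cs.simple i * cs.simple j with hp
  have hpinv : p⁻¹ = cs.simple j * cs.simple i := by simp [hp]
  have hconj : cs.simple j * p * cs.simple j = p⁻¹ := by
    rw [hpinv, hp]; simp [mul_assoc]
  have hconj' : ∀ l : ℕ, (p ^ l)⁻¹ * cs.simple j = cs.simple j * p ^ l := by
    intro l
    induction l with
    | zero => simp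
    | succ l ih =>
      have h1 : p⁻¹ * cs.simple j = cs.simple j * p := by
        rw [← hconj]; simp [mul_assoc]
      rw [pow_succ, mul_inv_rev, mul_assoc, ih, ← mul_assoc, h1, mul_assoc, ← pow_succ', pow_succ]
  induction k with
  | zero => simp [Function.End.one_def]
  | succ k ih =>
    rw [pow_succ', show ((cs.signedConj i * cs.signedConj j) *
      (cs.signedConj i * cs.signedConj j) ^ k) (t, e) = (cs.signedConj i) (cs.signedConj j
        (((cs.signedConj i * cs.signedConj j) ^ k) (t, e))) from rfl, ih]
    have e1 : p ^ k * t * (p ^ k)⁻¹ = cs.simple j ↔ t = cs.simple j * p ^ (2 * k) := by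
      rw [mul_inv_eq_iff_eq_mul, ← eq_inv_mul_iff_mul_eq, ← mul_assoc, hconj', mul_assoc,
        ← pow_add, two_mul]
    have e2 : cs.simple j * (p ^ k * t * (p ^ k)⁻¹) * cs.simple j = cs.simple i ↔
        t = cs.simple j * p ^ (2 * k + 1) := by
      have : cs.simple j * (p ^ k * t * (p ^ k)⁻¹) * cs.simple j = cs.simple i ↔
          p ^ k * t * (p ^ k)⁻¹ = cs.simple j * p := by
        constructor
        · intro h
          calc p ^ k * t * (p ^ k)⁻¹ = cs.simple j *
                (cs.simple j * (p ^ k * t * (p ^ k)⁻¹) * cs.simple j) * cs.simple j := by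
                simp [mul_assoc]
            _ = cs.simple j * p := by rw [h, hp, mul_assoc]
        · intro h
          rw [h, hp]; simp [mul_assoc]
      rw [this, mul_inv_eq_iff_eq_mul, ← eq_inv_mul_iff_mul_eq, ← mul_assoc, ← mul_assoc, hconj',
        mul_assoc, mul_assoc, ← pow_succ', ← pow_add]
      congr! 3
      ring
    simp only [signedConj, e1, e2]
    refine Prod.ext ?_ ?_
    · simp [pow_succ', hp, mul_assoc]
    · rw [show 2 * (k + 1) = 2 * k + 1 + 1 by ring, Finset.sum_range_succ, Finset.sum_range_succ]
      simp only [add_assoc]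

theorem signedConj_isLiftable : M.IsLiftable cs.signedConj := by
  classical
  intro i j
  funext ⟨t, e⟩
  rw [signedConj_mul_pow, cs.simple_mul_simple_pow]
  refine Prod.ext (by simp [Function.End.one_def]) ?_
  -- The inversion sequence of the braid relator has period `M i j`, so each term occurs twice.
  rw [two_mul, Finset.sum_range_add]
  simp only [pow_add, cs.simple_mul_simple_pow, one_mul]
  rw [CharTwo.add_self_eq_zero]
  simp [Function.End.one_def]

/-- The parity of the number of occurrences of `t` in the right inversion sequence of any word
for `w`. -/
noncomputable def invParity (w t : W) : ZMod 2 :=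
  (cs.lift ⟨cs.signedConj, cs.signedConj_isLiftable⟩ w (t, 0)).2

theorem lift_signedConj_apply (w t : W) (e : ZMod 2) :
    cs.lift ⟨cs.signedConj, cs.signedConj_isLiftable⟩ w (t, e) =
      (w * t * w⁻¹, e + cs.invParity w t) := by
  have key : ∀ w : W, ∀ t e, cs.lift ⟨cs.signedConj, cs.signedConj_isLiftable⟩ w (t, e) =
      (w * t * w⁻¹,
        e + (cs.lift ⟨cs.signedConj, cs.signedConj_isLiftable⟩ w (t, 0)).2) := by
    intro w
    induction w using cs.simple_induction_left with
    | one => intro t e; simp [Function.End.one_def]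
    | mul_simple_left w i ih =>
      intro t e
      have h : ∀ t e, cs.lift ⟨cs.signedConj, cs.signedConj_isLiftable⟩ (cs.simple i * w) (t, e) =
          cs.signedConj i (cs.lift ⟨cs.signedConj, cs.signedConj_isLiftable⟩ w (t, e)) := by
        intro t e
        rw [map_mul, cs.lift_apply_simple]
        rfl
      rw [h, h, ih t e, ih t 0]
      simp [signedConj, mul_assoc, add_assoc]
  exact key w t e

/-- The cocycle identity. -/
theorem invParity_mul (a b t : W) :
    cs.invParity (a * b) t = cs.invParity b t + cs.invParity a (b * t * b⁻¹) := by
  have h : cs.lift ⟨cs.signedConj, cs.signedConj_isLiftable⟩ (a * b) (t, 0) =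
      cs.lift ⟨cs.signedConj, cs.signedConj_isLiftable⟩ a
        (cs.lift ⟨cs.signedConj, cs.signedConj_isLiftable⟩ b (t, 0)) := by
    rw [map_mul]; rfl
  rw [lift_signedConj_apply, lift_signedConj_apply, lift_signedConj_apply] at h
  simpa using congrArg Prod.snd h

open scoped Classical in
theorem invParity_simple (i : B) (t : W) :
    cs.invParity (cs.simple i) t = if t = cs.simple i then 1 else 0 := by
  simp [invParity, cs.lift_apply_simple, signedConj]

theorem invParity_one (t : W) : cs.invParity 1 t = 0 := by
  simp [invParity, Function.End.one_def]

theorem length_wordProd_mul_lt_of_invParity_eq_one (ω : List B) (t : W)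
    (h : cs.invParity (cs.wordProd ω) t = 1) :
    cs.length (cs.wordProd ω * t) < ω.length := by
  classical
  induction ω with
  | nil => simp [invParity_one] at h
  | cons i ω ih =>
    rw [cs.wordProd_cons] at h ⊢
    rw [invParity_mul, invParity_simple] at h
    split_ifs at h with hi
    · have e : cs.simple i * cs.wordProd ω * t = cs.wordProd ω := by
        have : cs.wordProd ω * t = cs.simple i * cs.wordProd ω := by rw [← hi]; group
        rw [mul_assoc, this, cs.simple_mul_simple_cancel_left]
      rw [e]
      exact Nat.lt_succ_of_le (cs.length_wordProd_le ω)
    · have h1 := ih (by simpa using h)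
      have h2 := cs.length_mul_le (cs.simple i) (cs.wordProd ω * t)
      rw [cs.length_simple] at h2
      rw [mul_assoc, List.length_cons]
      omega

theorem length_mul_lt_of_invParity_eq_one {w t : W} (h : cs.invParity w t = 1) :
    cs.length (w * t) < cs.length w := by
  obtain ⟨ω, hω, rfl⟩ := cs.exists_isReduced w
  rw [hω.eq]
  exact cs.length_wordProd_mul_lt_of_invParity_eq_one ω t h

theorem invParity_simple_eq_one_iff {w : W} {i : B} :
    cs.invParity w (cs.simple i) = 1 ↔ cs.length (w * cs.simple i) < cs.length w := by
  refine ⟨cs.length_mul_lt_of_invParity_eq_one, fun h => ?_⟩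
  by_contra hne
  have h0 : cs.invParity w (cs.simple i) = 0 := by
    generalize cs.invParity w (cs.simple i) = a at hne
    revert hne a; decide
  have h1 : cs.invParity (w * cs.simple i) (cs.simple i) = 1 := by
    rw [invParity_mul, invParity_simple]
    simp [h0]
  have := cs.length_mul_lt_of_invParity_eq_one h1
  rw [cs.simple_mul_simple_cancel_right] at this
  omega

/-- A form of the exchange property which mentions no words: if `s_i` is a right descent of `a * b`,
then the letter deleted from a word for `a * b` lies either in the part for `a` or in the part
for `b`. -/
theorem exchange_mul {a b : W} {i : B}
    (h : cs.length (a * b * cs.simple i) < cs.length (a * b)) :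
    cs.length (a * (b * cs.simple i * b⁻¹)) < cs.length a ∨
      cs.length (b * cs.simple i) < cs.length b := by
  rw [← invParity_simple_eq_one_iff, invParity_mul] at h
  by_cases hb : cs.invParity b (cs.simple i) = 1
  · exact Or.inr (cs.length_mul_lt_of_invParity_eq_one hb)
  · refine Or.inl (cs.length_mul_lt_of_invParity_eq_one ?_)
    generalize cs.invParity b (cs.simple i) = x at h hb
    generalize cs.invParity a _ = y at h ⊢
    revert x y; decide

/-- The inversions of the elements of `W_J` lie in `W_J`. -/
theorem mem_parabolic_of_invParity_eq_one {J : Set B} {z : W} (hz : z ∈ cs.parabolic J) :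
    ∀ t, cs.invParity z t = 1 → t ∈ cs.parabolic J := by
  classical
  induction hz using Subgroup.closure_induction with
  | mem x hx =>
    obtain ⟨i, hi, rfl⟩ := hx
    intro t ht
    rw [invParity_simple] at ht
    split_ifs at ht with h
    · exact h ▸ Subgroup.subset_closure ⟨i, hi, rfl⟩
    · simp at ht
  | one => intro t ht; simp [invParity_one] at ht
  | mul a b ha hb iha ihb =>
    intro t ht
    rw [invParity_mul] at ht
    by_cases h : cs.invParity b t = 1
    · exact ihb t h
    · have h' : cs.invParity a (b * t * b⁻¹) = 1 := by
        generalize cs.invParity b t = x at h ht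
        generalize cs.invParity a _ = y at ht ⊢
        revert x y; decide
      have := mul_mem (mul_mem (inv_mem hb) (iha _ h')) hb
      exact (by simpa [mul_assoc] using this : t ∈ Subgroup.closure (cs.simple '' J))
  | inv a ha iha =>
    intro t ht
    have h := cs.invParity_mul a a⁻¹ t
    rw [mul_inv_cancel, invParity_one, ht] at h
    have h' : cs.invParity a (a⁻¹ * t * a⁻¹⁻¹) = 1 := by
      generalize cs.invParity a _ = y at h ⊢
      revert y; decide
    have := mul_mem (mul_mem ha (iha _ h')) (inv_mem ha)
    exact (by simpa [mul_assoc] using this : t ∈ Subgroup.closure (cs.simple '' J))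

/-! ### The geometric representation -/

/-- The linear form `v ↦ 2 ⟨α_i, v⟩`, where `⟨α_i, α_j⟩ = -cos (π / M i j)`. Since `π / 0 = 0`, an
infinite label, encoded by `0`, gives `⟨α_i, α_j⟩ = -1`. -/
noncomputable def simpleCoroot (M : CoxeterMatrix B) (i : B) : Module.Dual ℝ (B →₀ ℝ) :=
  Finsupp.linearCombination ℝ fun j => -2 * Real.cos (Real.pi / M i j)

theorem simpleCoroot_single (M : CoxeterMatrix B) (i j : B) :
    simpleCoroot M i (Finsupp.single j 1) = -2 * Real.cos (Real.pi / M i j) := by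
  simp [simpleCoroot]

theorem simpleCoroot_self (M : CoxeterMatrix B) (i : B) :
    simpleCoroot M i (Finsupp.single i 1) = 2 := by
  simp [simpleCoroot_single]

open Polynomial.Chebyshev in
/-- The reflections `v ↦ v - 2 ⟨α_i, v⟩ α_i` satisfy the Coxeter relations. -/
theorem reflection_isLiftable (M : CoxeterMatrix B) :
    M.IsLiftable fun i => Module.reflection (simpleCoroot_self M i) := by
  intro i j
  by_cases hij : i = j
  · subst hij
    rw [M.diagonal, pow_one]
    ext1 v
    exact Module.involutive_reflection (simpleCoroot_self M i) v
  set m := M i j with hm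
  -- For `m ≥ 3` the Chebyshev polynomials are evaluated by `S n (2 cos θ) = sin ((n + 1) θ) / sin θ`
  -- with `θ = 2 π / m`; the denominator vanishes for `m = 2`, where the reflections are orthogonal.
  rcases Nat.lt_or_ge m 3 with hlt | hge
  · have h1 : m ≠ 1 := M.off_diagonal i j hij
    interval_cases m
    · simp
    · exact absurd rfl h1
    · ext1 v
      have h2 : M j i = 2 := by rw [M.symmetric, ← hm]
      rw [Module.reflection_mul_reflection_pow_apply]
      simp only [simpleCoroot_single, ← hm, h2]
      norm_num
      abel
  · have hmpos : (0 : ℝ) < m := by positivity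
    have hm3 : (3 : ℝ) ≤ m := by exact_mod_cast hge
    set θ : ℝ := 2 * Real.pi / m with hθ
    have hsin : Real.sin θ ≠ 0 := by
      refine (Real.sin_pos_of_pos_of_lt_pi (by positivity) ?_).ne'
      rw [hθ, div_lt_iff₀ hmpos]
      nlinarith [Real.pi_pos]
    have ht : (2 * Real.cos θ : ℝ) = simpleCoroot M i (Finsupp.single j 1) *
        simpleCoroot M j (Finsupp.single i 1) - 2 := by
      rw [simpleCoroot_single, simpleCoroot_single, M.symmetric j i, ← hm, hθ,
        show 2 * Real.pi / (m : ℝ) = 2 * (Real.pi / m) by ring, Real.cos_two_mul]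
      ring
    have hS : ∀ n : ℤ, (S ℝ n).eval (2 * Real.cos θ) = Real.sin ((n + 1) * θ) / Real.sin θ :=
      fun n => by rw [eq_div_iff hsin, S_two_mul_real_cos]
    ext1 v
    rw [Module.reflection_mul_reflection_pow_apply _ _ _ _ _ ht]
    simp only [hS]
    rcases Nat.even_or_odd' m with ⟨k, hk | hk⟩
    · have e1 : ((m : ℤ) - 2) / 2 = k - 1 := by omega
      have e2 : ((m : ℤ) - 1) / 2 = k - 1 := by omega
      have hz : Real.sin (((k - 1 : ℤ) + 1) * θ) = 0 := by
        have : (((k - 1 : ℤ) : ℝ) + 1) * θ = Real.pi := by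
          have : (m : ℝ) = 2 * k := by exact_mod_cast hk
          rw [hθ]; push_cast; field_simp; rw [this]; ring
        rw [this, Real.sin_pi]
      rw [e1, e2, hz]
      simp
    · have e1 : ((m : ℤ) - 2) / 2 = k - 1 := by omega
      have e2 : ((m : ℤ) - 1) / 2 = k := by omega
      have e3 : ((m : ℤ) - 3) / 2 = k - 1 := by omega
      have e4 : (m : ℤ) / 2 = k := by omega
      have hz : Real.sin (((k : ℤ) + 1) * θ) = -Real.sin (((k - 1 : ℤ) + 1) * θ) := by
        have : (((k : ℤ) : ℝ) + 1) * θ = 2 * Real.pi - (((k - 1 : ℤ) : ℝ) + 1) * θ := by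
          have : (m : ℝ) = 2 * k + 1 := by exact_mod_cast hk
          rw [hθ]; push_cast; field_simp; rw [this]; ring
        rw [this, Real.sin_two_pi_sub]
      rw [e1, e2, e3, e4, hz]
      simp [neg_div]

/-- The elements of `W_J` change only the coordinates in `J` of a vector of the geometric
representation, whereas `s_i` maps `α_i` to `-α_i`. -/
theorem simple_mem_parabolic_iff {J : Set B} {i : B} :
    cs.simple i ∈ cs.parabolic J ↔ i ∈ J := by
  refine ⟨fun h => ?_, fun h => Subgroup.subset_closure ⟨i, h, rfl⟩⟩
  by_contra hi
  set ρ := cs.lift ⟨_, reflection_isLiftable M⟩ with hρ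
  have key : ∀ w ∈ cs.parabolic J, ∀ v : B →₀ ℝ, ρ w v i = v i := by
    intro w hw
    induction hw using Subgroup.closure_induction with
    | mem x hx =>
      obtain ⟨j, hj, rfl⟩ := hx
      intro v
      have hji : j ≠ i := fun h => hi (h ▸ hj)
      rw [hρ, cs.lift_apply_simple, Module.reflection_apply]
      simp [Finsupp.single_eq_of_ne hji.symm]
    | one => intro v; simp
    | mul a b _ _ iha ihb => intro v; rw [map_mul, LinearEquiv.mul_apply, iha, ihb]
    | inv a _ iha =>
      intro v
      rw [← iha, ← LinearEquiv.mul_apply, ← map_mul, mul_inv_cancel, map_one]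
      rfl
  have h1 := key _ h (Finsupp.single i 1)
  rw [hρ, cs.lift_apply_simple, Module.reflection_apply_self] at h1
  norm_num at h1

/-! ### Minimal coset representatives -/

theorem mem_of_rightDescent_of_mem_parabolic {J : Set B} {z : W} {i : B}
    (hz : z ∈ cs.parabolic J) (hi : cs.length (z * cs.simple i) < cs.length z) : i ∈ J :=
  cs.simple_mem_parabolic_iff.1
    (cs.mem_parabolic_of_invParity_eq_one hz _ (cs.invParity_simple_eq_one_iff.2 hi))

/-- Induction on the elements of `W_J` along reduced words. -/
theorem parabolic_induction {J : Set B} {p : W → Prop} (one : p 1)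
    (mul_simple : ∀ z ∈ cs.parabolic J, ∀ i ∈ J, cs.length z < cs.length (z * cs.simple i) →
      p z → p (z * cs.simple i)) {z : W} (hz : z ∈ cs.parabolic J) : p z := by
  induction hn : cs.length z using Nat.strong_induction_on generalizing z with
  | _ n ih =>
    by_cases h1 : z = 1
    · exact h1 ▸ one
    obtain ⟨i, hi⟩ := cs.exists_rightDescent_of_ne_one h1
    have hiJ := cs.mem_of_rightDescent_of_mem_parabolic hz hi
    have hz' := mul_mem hz (cs.simple_mem_parabolic_iff.2 hiJ)
    have hi' : cs.length (z * cs.simple i) < cs.length z := hi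
    have := mul_simple _ hz' i hiJ (by rwa [cs.simple_mul_simple_cancel_right])
      (ih _ (hn ▸ hi') hz' rfl)
    rwa [cs.simple_mul_simple_cancel_right] at this

/-- Lengths add up on a coset of `W_J` whose shortest element is `x`: a letter deleted from a word for
`x` would give a shorter element of the coset. -/
theorem length_mul_of_forall_le {J : Set B} {x : W}
    (hx : ∀ q ∈ cs.parabolic J, cs.length x ≤ cs.length (x * q)) {q : W}
    (hq : q ∈ cs.parabolic J) : cs.length (x * q) = cs.length x + cs.length q := by
  refine cs.parabolic_induction (p := fun q => cs.length (x * q) = cs.length x + cs.length q)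
    (by simp) (fun q hq i hi hlt ih => ?_) hq
  rcases cs.length_mul_simple (x * q) i with h | h
  · have := cs.length_mul_simple q i
    rw [← mul_assoc]
    omega
  · exfalso
    rcases cs.exchange_mul (a := x) (b := q) (i := i) (by omega) with h' | h'
    · have := hx (q * cs.simple i * q⁻¹)
        (mul_mem (mul_mem hq (cs.simple_mem_parabolic_iff.2 hi)) (inv_mem hq))
      omega
    · omega

theorem exists_forall_length_mul (J : Set B) (w : W) :
    ∃ x, x⁻¹ * w ∈ cs.parabolic J ∧
      ∀ q ∈ cs.parabolic J, cs.length (x * q) = cs.length x + cs.length q := by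
  obtain ⟨x, hx, hmin⟩ := exists_minimalFor_of_wellFoundedLT
    (fun x => x⁻¹ * w ∈ cs.parabolic J) cs.length ⟨w, by simp⟩
  refine ⟨x, hx, fun q hq => cs.length_mul_of_forall_le (fun q hq => ?_) hq⟩
  by_contra! hlt
  have := hmin (j := x * q) (by simpa [mul_assoc] using mul_mem (inv_mem hq) hx) hlt.le
  omega

/-- An element of `W^J` is the shortest element of its coset, as otherwise it would have a right
descent in `J`. -/
theorem length_mul_of_mem_parabolicQuotient {J : Set B} {x q : W}
    (hx : x ∈ cs.parabolicQuotient J) (hq : q ∈ cs.parabolic J) :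
    cs.length (x * q) = cs.length x + cs.length q := by
  obtain ⟨y, hy, hadd⟩ := cs.exists_forall_length_mul J x
  suffices h : y⁻¹ * x = 1 by
    rw [inv_mul_eq_one.1 h] at hadd
    exact hadd q hq
  by_contra hne
  obtain ⟨i, hi⟩ := cs.exists_rightDescent_of_ne_one hne
  have hi' : cs.length (y⁻¹ * x * cs.simple i) < cs.length (y⁻¹ * x) := hi
  have hiJ := cs.mem_of_rightDescent_of_mem_parabolic hy hi
  have h1 := hadd _ hy
  have h2 := hadd _ (mul_mem hy (cs.simple_mem_parabolic_iff.2 hiJ))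
  rw [mul_inv_cancel_left] at h1
  rw [mul_assoc, mul_inv_cancel_left] at h2
  rw [mul_assoc] at hi'
  have := hx i hiJ
  omega

theorem proj_mem_parabolicQuotient (J : Set B) (w : W) :
    cs.proj J w ∈ cs.parabolicQuotient J :=
  (cs.exists_parabolic_factorization J w).choose_spec.1

theorem inv_proj_mul_mem (J : Set B) (w : W) : (cs.proj J w)⁻¹ * w ∈ cs.parabolic J := by
  obtain ⟨y, hy, h, -⟩ := (cs.exists_parabolic_factorization J w).choose_spec.2
  have h' : w = cs.proj J w * y := h
  rwa [inv_mul_eq_iff_eq_mul.2 h']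

theorem length_proj_le_of_mem {J : Set B} {w w' : W} (h : w⁻¹ * w' ∈ cs.parabolic J) :
    cs.length (cs.proj J w) ≤ cs.length w' := by
  have := cs.length_mul_of_mem_parabolicQuotient (cs.proj_mem_parabolicQuotient J w)
    (mul_mem (cs.inv_proj_mul_mem J w) h)
  rw [mul_assoc, mul_inv_cancel_left, mul_inv_cancel_left] at this
  omega

theorem proj_eq_proj_iff {J : Set B} {w w' : W} :
    cs.proj J w = cs.proj J w' ↔ w⁻¹ * w' ∈ cs.parabolic J := by
  have hw := cs.inv_proj_mul_mem J w
  have hw' := cs.inv_proj_mul_mem J w'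
  constructor
  · intro h
    rw [← h] at hw'
    simpa [mul_assoc] using mul_mem (inv_mem hw) hw'
  · intro h
    have hmem : (cs.proj J w)⁻¹ * cs.proj J w' ∈ cs.parabolic J := by
      simpa [mul_assoc] using mul_mem (mul_mem hw h) (inv_mem hw')
    have h1 := cs.length_mul_of_mem_parabolicQuotient (cs.proj_mem_parabolicQuotient J w) hmem
    have h2 := cs.length_mul_of_mem_parabolicQuotient (cs.proj_mem_parabolicQuotient J w')
      (inv_mem hmem)
    rw [mul_inv_cancel_left] at h1
    rw [cs.length_inv, mul_inv_rev, inv_inv, mul_inv_cancel_left] at h2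
    have h3 : cs.length ((cs.proj J w)⁻¹ * cs.proj J w') = 0 := by omega
    exact inv_mul_eq_one.1 (cs.length_eq_zero_iff.1 h3)

/-- The intersection of the maximal parabolic subgroups `W_{S ∖ {i}}`, `i ∈ D`, is `W_{S ∖ D}`. -/
theorem mem_parabolic_of_forall {D : Set B} {z : W}
    (h : ∀ i ∈ D, z ∈ cs.parabolic {i}ᶜ) : z ∈ cs.parabolic Dᶜ := by
  induction hn : cs.length z using Nat.strong_induction_on generalizing z with
  | _ n ih =>
    by_cases h1 : z = 1
    · exact h1 ▸ one_mem _
    obtain ⟨t, ht⟩ := cs.exists_rightDescent_of_ne_one h1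
    have ht' : cs.length (z * cs.simple t) < cs.length z := ht
    have hne : ∀ i ∈ D, t ∈ ({i}ᶜ : Set B) := fun i hi =>
      cs.mem_of_rightDescent_of_mem_parabolic (h i hi) ht
    have htD : t ∈ Dᶜ := fun hD => hne t hD rfl
    have := ih _ (hn ▸ ht')
      (fun i hi => mul_mem (h i hi) (cs.simple_mem_parabolic_iff.2 (hne i hi))) rfl
    simpa [cs.simple_mul_simple_cancel_right] using
      mul_mem this (cs.simple_mem_parabolic_iff.2 htD)

/-- Going up in the weak order by `s_i` moves the projection to `W^{S ∖ {i}}` to a longer element: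
the letter deleted from a word for `(w s_i)^J (w s_i)_J` to obtain `w` lies in the first factor, so
`w W_J` contains an element shorter than `(w s_i)^J`. -/
theorem length_proj_lt {w : W} {i : B} (h : cs.length w < cs.length (w * cs.simple i)) :
    cs.length (cs.proj {i}ᶜ w) < cs.length (cs.proj {i}ᶜ (w * cs.simple i)) := by
  set x := cs.proj {i}ᶜ (w * cs.simple i) with hx
  have hy := cs.inv_proj_mul_mem {i}ᶜ (w * cs.simple i)
  rw [← hx] at hy
  set y := x⁻¹ * (w * cs.simple i) with hyx
  have hxy : x * y = w * cs.simple i := mul_inv_cancel_left _ _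
  rcases cs.exchange_mul (a := x) (b := y) (i := i)
    (by rwa [hxy, cs.simple_mul_simple_cancel_right]) with h' | h'
  · refine lt_of_le_of_lt (cs.length_proj_le_of_mem ?_) h'
    have e : x * (y * cs.simple i * y⁻¹) = w * y⁻¹ := by
      rw [← mul_assoc, ← mul_assoc, hxy, cs.simple_mul_simple_cancel_right]
    rw [e, inv_mul_cancel_left]
    exact inv_mem hy
  · exact absurd rfl (cs.mem_of_rightDescent_of_mem_parabolic hy h')

theorem proj_mul_simple {J : Set B} {i : B} (hi : i ∈ J) (w : W) :
    cs.proj J (w * cs.simple i) = cs.proj J w := by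
  rw [eq_comm, proj_eq_proj_iff, inv_mul_cancel_left]
  exact cs.simple_mem_parabolic_iff.2 hi

/-! ### The right weak order -/

/-- The right weak order is the prefix order. -/
theorem rightWeakLE_iff {u v : W} :
    cs.RightWeakLE u v ↔ cs.length v = cs.length u + cs.length (u⁻¹ * v) := by
  constructor
  · intro h
    induction h with
    | refl => simp
    | tail _ h ih =>
      rename_i b c _
      obtain ⟨hlt, i, hi⟩ := h
      have hc : c = b * cs.simple i := by rw [hi, mul_inv_cancel_left]
      subst hc
      have h1 := cs.length_mul_simple b i
      have h2 := cs.length_mul_le u (u⁻¹ * (b * cs.simple i))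
      have h3 := cs.length_mul_simple (u⁻¹ * b) i
      rw [mul_inv_cancel_left] at h2
      rw [mul_assoc] at h3
      omega
  · intro h
    induction hn : cs.length (u⁻¹ * v) generalizing v with
    | zero =>
      rw [← inv_mul_eq_one.1 (cs.length_eq_zero_iff.1 hn)]
      exact Relation.ReflTransGen.refl
    | succ n ih =>
      have hne : u⁻¹ * v ≠ 1 := fun h0 => by simp [h0] at hn
      obtain ⟨i, hi⟩ := cs.exists_rightDescent_of_ne_one hne
      have hi' : cs.length (u⁻¹ * v * cs.simple i) < cs.length (u⁻¹ * v) := hi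
      have h1 := cs.length_mul_le u (u⁻¹ * (v * cs.simple i))
      have h2 := cs.length_mul_simple v i
      have h3 := cs.length_mul_simple (u⁻¹ * v) i
      rw [mul_inv_cancel_left] at h1
      rw [mul_assoc] at h3 hi'
      refine (ih (v := v * cs.simple i) (by omega) (by omega)).tail ⟨by omega, i, ?_⟩
      simp

theorem RightWeakLE.trans {u v w : W} (h : cs.RightWeakLE u v) (h' : cs.RightWeakLE v w) :
    cs.RightWeakLE u w :=
  Relation.ReflTransGen.trans h h'

theorem rightWeakLE_mul_simple {w : W} {i : B} (h : cs.length w < cs.length (w * cs.simple i)) :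
    cs.RightWeakLE w (w * cs.simple i) :=
  Relation.ReflTransGen.single ⟨h, i, by simp⟩

theorem exists_mul_simple_of_rightWeakLE {g y : W} (h : cs.RightWeakLE g y) (hne : g ≠ y) :
    ∃ i, cs.length (g⁻¹ * y * cs.simple i) < cs.length (g⁻¹ * y) ∧
      cs.length (y * cs.simple i) < cs.length y ∧ cs.RightWeakLE g (y * cs.simple i) := by
  rw [rightWeakLE_iff] at h
  obtain ⟨i, hi⟩ := cs.exists_rightDescent_of_ne_one (mt inv_mul_eq_one.1 hne)
  have hi' : cs.length (g⁻¹ * y * cs.simple i) < cs.length (g⁻¹ * y) := hi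
  have h1 := cs.length_mul_le g (g⁻¹ * (y * cs.simple i))
  rw [mul_inv_cancel_left, ← mul_assoc] at h1
  refine ⟨i, hi, by omega, ?_⟩
  rw [rightWeakLE_iff, ← mul_assoc]
  have h2 := cs.length_mul_simple y i
  have h3 := cs.length_mul_simple (g⁻¹ * y) i
  omega

/-- The elements above `u` in a coset of `W_J` have a least element, namely the element `g` of the
coset nearest to `u`. With `m` the shortest element of the coset, distances from `1` and from `u`
to an element `c` of the coset are measured through `m` and through `g`, so `c` is above `u` iff
`ℓ (m⁻¹ c) - ℓ (g⁻¹ c)` attains its upper bound `ℓ (m⁻¹ g)`. -/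
theorem exists_forall_rightWeakLE_iff {J : Set B} {u y : W} (huy : cs.RightWeakLE u y) :
    ∃ g, g⁻¹ * y ∈ cs.parabolic J ∧
      ∀ c, y⁻¹ * c ∈ cs.parabolic J → (cs.RightWeakLE u c ↔ cs.RightWeakLE g c) := by
  obtain ⟨m, hm, hmadd⟩ := cs.exists_forall_length_mul J y
  obtain ⟨g', hg, hgadd⟩ := cs.exists_forall_length_mul J (u⁻¹ * y)
  obtain ⟨g, rfl⟩ : ∃ g, g' = u⁻¹ * g := ⟨u * g', by simp⟩
  have hgy : g⁻¹ * y ∈ cs.parabolic J := by simpa [mul_assoc] using hg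
  have hm' : ∀ c, y⁻¹ * c ∈ cs.parabolic J →
      cs.length c = cs.length m + cs.length (m⁻¹ * c) := fun c hc => by
    have := hmadd (m⁻¹ * c) (by simpa [mul_assoc] using mul_mem hm hc)
    rwa [mul_inv_cancel_left] at this
  have hg' : ∀ c, y⁻¹ * c ∈ cs.parabolic J →
      cs.length (u⁻¹ * c) = cs.length (u⁻¹ * g) + cs.length (g⁻¹ * c) := fun c hc => by
    have := hgadd (g⁻¹ * c) (by simpa [mul_assoc] using mul_mem hgy hc)
    rwa [mul_assoc, mul_inv_cancel_left] at this
  have hyg : y⁻¹ * g ∈ cs.parabolic J := by simpa using inv_mem hgy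
  refine ⟨g, hgy, fun c hc => ?_⟩
  rw [rightWeakLE_iff] at huy
  have g1 := hm' g hyg
  have g2 := cs.length_mul_le u (u⁻¹ * g)
  have y1 := hm' y (by simp)
  have y2 := hg' y (by simp)
  have y3 := cs.length_mul_le (m⁻¹ * g) (g⁻¹ * y)
  have c1 := hm' c hc
  have c2 := hg' c hc
  rw [mul_inv_cancel_left] at g2
  rw [mul_assoc, mul_inv_cancel_left] at y3
  rw [rightWeakLE_iff, rightWeakLE_iff]
  omega

/-- An element of a coset of `W_J` that lies above `u` and is minimal with this property among its
neighbours in the coset lies below all elements of the coset above `u`. -/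
theorem rightWeakLE_of_forall_not {J : Set B} {u x y : W} (hux : cs.RightWeakLE u x)
    (huy : cs.RightWeakLE u y) (hyx : y⁻¹ * x ∈ cs.parabolic J)
    (hmin : ∀ i ∈ J, cs.length (y * cs.simple i) < cs.length y →
      ¬ cs.RightWeakLE u (y * cs.simple i)) : cs.RightWeakLE y x := by
  obtain ⟨g, hgy, hg⟩ := cs.exists_forall_rightWeakLE_iff (J := J) huy
  have hle : cs.RightWeakLE g y := (hg y (by simp)).1 huy
  have hgx : cs.RightWeakLE g x := (hg x hyx).1 hux
  by_cases hne : g = y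
  · exact hne ▸ hgx
  · obtain ⟨i, hi, hlt, hle'⟩ := cs.exists_mul_simple_of_rightWeakLE hle hne
    have hiJ := cs.mem_of_rightDescent_of_mem_parabolic hgy hi
    refine absurd ((hg _ ?_).2 hle') (hmin i hiJ hlt)
    rw [inv_mul_cancel_left]
    exact cs.simple_mem_parabolic_iff.2 hiJ

/-- The step of the shelling: going down from `y` inside an interval of the right weak order, one
can leave a vertex of `P(y)` which is not a vertex of `P(x)`. -/
theorem exists_mul_simple_proj_ne {u v x y : W} (hx : x ∈ cs.rightWeakInterval u v)
    (hy : y ∈ cs.rightWeakInterval u v) (hyx : ¬ cs.RightWeakLE y x) :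
    ∃ i, cs.length (y * cs.simple i) < cs.length y ∧
      y * cs.simple i ∈ cs.rightWeakInterval u v ∧ cs.proj {i}ᶜ y ≠ cs.proj {i}ᶜ x := by
  by_contra! hcon
  set D : Set B := {i | cs.length (y * cs.simple i) < cs.length y ∧
    cs.RightWeakLE u (y * cs.simple i)} with hD
  refine hyx (cs.rightWeakLE_of_forall_not (J := Dᶜ) hx.1 hy.1
    (cs.mem_parabolic_of_forall fun i hi => ?_) fun i hi hlt hle => hi ⟨hlt, hle⟩)
  refine cs.proj_eq_proj_iff.1 (hcon i hi.1 ⟨hi.2, RightWeakLE.trans cs ?_ hy.2⟩)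
  have := cs.rightWeakLE_mul_simple (w := y * cs.simple i) (i := i)
    (by rw [cs.simple_mul_simple_cancel_right]; exact hi.1)
  rwa [cs.simple_mul_simple_cancel_right] at this

theorem finite_length_le [Finite B] (n : ℕ) : {w : W | cs.length w ≤ n}.Finite := by
  refine ((List.finite_length_le B n).image cs.wordProd).subset fun w hw => ?_
  obtain ⟨ω, hω, rfl⟩ := cs.exists_isReduced w
  exact ⟨ω, hω.eq.symm.le.trans hw, rfl⟩

theorem finite_rightWeakInterval [Finite B] (u v : W) : (cs.rightWeakInterval u v).Finite :=
  (cs.finite_length_le (cs.length v)).subset fun w hw => by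
    have := cs.rightWeakLE_iff.1 hw.2
    simp only [Set.mem_ofPred_eq]
    omega

end CoxeterSystem

/-! ### Labelings and the Gale order -/

/-- A finite type can be numbered along any function to `ℕ`, with ties broken arbitrarily. -/
theorem exists_equiv_fin_lt_of_lt {α : Type*} [Finite α] (key : α → ℕ) :
    ∃ σ : α ≃ Fin (Nat.card α), ∀ a b, key a < key b → σ a < σ b := by
  set e := Finite.equivFin α
  set π := Tuple.sort (key ∘ e.symm)
  refine ⟨e.trans π.symm, fun a b h => ?_⟩
  by_contra! hle
  have := Tuple.monotone_sort (key ∘ e.symm) hle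
  simp [π] at this
  omega

theorem exists_isLinearExtension {n k : ℕ} (P : Set (IncTuple n k)) :
    ∃ L : P ≃ Fin (Nat.card P), IsLinearExtension L := by
  -- The sum of the entries is strictly monotone.
  obtain ⟨L, hL⟩ := exists_equiv_fin_lt_of_lt fun x : P => ∑ i, (x.1.1 i : ℕ)
  refine ⟨L, fun x y hxy => hL x y ?_⟩
  obtain ⟨hle, i, hi⟩ := Pi.lt_def.1 (show x.1.1 < y.1.1 from hxy)
  exact Finset.sum_lt_sum (fun j _ => hle j) ⟨i, Finset.mem_univ i, hi⟩

/-- The criterion for the Gale order by counting the elements of initial segments. -/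
theorem orderEmbOfFin_le_of_card_filter_le {α : Type*} [LinearOrder α] {k : ℕ} {s t : Finset α}
    (hs : s.card = k) (ht : t.card = k)
    (h : ∀ c, (t.filter (· ≤ c)).card ≤ (s.filter (· ≤ c)).card) (i : Fin k) :
    s.orderEmbOfFin hs i ≤ t.orderEmbOfFin ht i := by
  by_contra! hlt
  set x := s.orderEmbOfFin hs with hx
  set y := t.orderEmbOfFin ht with hy
  have h1 : (Finset.Iic i).map y.toEmbedding ⊆ t.filter (· ≤ y i) := by
    intro c hc
    obtain ⟨j, hj, rfl⟩ := Finset.mem_map.1 hc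
    exact Finset.mem_filter.2 ⟨t.orderEmbOfFin_mem ht j, y.monotone (Finset.mem_Iic.1 hj)⟩
  have h2 : s.filter (· ≤ y i) ⊆ (Finset.Iio i).map x.toEmbedding := by
    intro c hc
    obtain ⟨hcs, hci⟩ := Finset.mem_filter.1 hc
    obtain ⟨j, rfl⟩ : c ∈ Set.range x := by rw [hx, Finset.range_orderEmbOfFin]; exact hcs
    exact Finset.mem_map.2 ⟨j, Finset.mem_Iio.2 (x.lt_iff_lt.1 (hci.trans_lt hlt)), rfl⟩
  have h3 := Finset.card_le_card h1
  have h4 := Finset.card_le_card h2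
  have h5 := h (y i)
  rw [Finset.card_map, Fin.card_Iic] at h3
  rw [Finset.card_map, Fin.card_Iio] at h4
  omega

theorem orderEmbOfFin_le_of_eq_insert_erase {α : Type*} [LinearOrder α] {k : ℕ} {s t : Finset α}
    (hs : s.card = k) (ht : t.card = k) {a b : α} (ha : a ∈ s) (hab : a < b)
    (hst : t = insert b (s.erase a)) (i : Fin k) :
    s.orderEmbOfFin hs i ≤ t.orderEmbOfFin ht i := by
  refine orderEmbOfFin_le_of_card_filter_le hs ht (fun c => ?_) i
  refine Finset.card_le_card_of_injOn (fun x => if x = b then a else x) (fun x hx => ?_)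
    fun x hx y hy hxy => ?_
  · obtain ⟨hxt, hxc⟩ := Finset.mem_filter.1 hx
    rw [Finset.mem_coe, Finset.mem_filter]
    dsimp only
    split_ifs with h
    · exact ⟨ha, hab.le.trans (h ▸ hxc)⟩
    · rw [hst, Finset.mem_insert, or_iff_right h] at hxt
      exact ⟨Finset.mem_of_mem_erase hxt, hxc⟩
  · have hne : ∀ z, z ∈ (t.filter (· ≤ c) : Set α) → z ≠ a := by
      rintro z hz rfl
      have := (Finset.mem_filter.1 hz).1
      rw [hst, Finset.mem_insert] at this
      rcases this with h | h
      · exact hab.ne h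
      · exact Finset.notMem_erase _ _ h
    dsimp only at hxy
    split_ifs at hxy with h1 h2 h2
    · rw [h1, h2]
    · exact absurd hxy.symm (hne y hy)
    · exact absurd hxy (hne x hx)
    · exact hxy

namespace PreAbstractSimplicialComplex

variable {ι : Type*} (X : PreAbstractSimplicialComplex ι) {n d : ℕ}

theorem mem_labels {σ : X.vertices ≃ Fin n} {F : X.facets} {c : Fin n} :
    c ∈ X.labels σ F ↔ (σ.symm c).1 ∈ F.1 := by
  rw [labels, Finset.mem_map]
  constructor
  · rintro ⟨v, -, rfl⟩
    change (σ.symm (σ ⟨v.1, _⟩)).1 ∈ F.1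
    rw [Equiv.symm_apply_apply]
    exact v.2
  · exact fun h => ⟨⟨_, h⟩, Finset.mem_attach _ _, σ.apply_symm_apply c⟩

theorem toSet_inducedMap (hX : X.IsPure d) (σ : X.vertices ≃ Fin n) (F : X.facets) :
    (X.inducedMap hX σ F).toSet = X.labels σ F :=
  Finset.range_orderEmbOfFin _ _

/-- The exchange of a vertex `p` for `q` exchanges the label of `p` for that of `q`. -/
theorem labels_eq_insert_erase [DecidableEq ι] (σ : X.vertices ≃ Fin n) {F G : X.facets}
    {p q : X.vertices} (h : G.1 = insert q.1 (F.1.erase p.1)) :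
    X.labels σ G = insert (σ q) ((X.labels σ F).erase (σ p)) := by
  ext c
  rw [mem_labels, h]
  simp only [Finset.mem_insert, Finset.mem_erase, mem_labels, ne_eq, Subtype.coe_inj,
    Equiv.symm_apply_eq]

theorem inducedMap_le_of_eq_insert_erase [DecidableEq ι] (hX : X.IsPure d)
    (σ : X.vertices ≃ Fin n) {F G : X.facets} {p q : X.vertices} (hp : p.1 ∈ F.1)
    (hpq : σ p < σ q) (h : G.1 = insert q.1 (F.1.erase p.1)) :
    X.inducedMap hX σ F ≤ X.inducedMap hX σ G :=
  orderEmbOfFin_le_of_eq_insert_erase _ _ (X.mem_labels.2 (by simpa)) hpq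
    (X.labels_eq_insert_erase σ h)

end PreAbstractSimplicialComplex

/-! ### The Coxeter complex of an interval -/

namespace CoxeterSystem

variable {B W : Type*} [Group W] {M : CoxeterMatrix B} (cs : CoxeterSystem M W) [Fintype B]

theorem mem_coxeterFacet {w : W} {p : W × B} :
    p ∈ cs.coxeterFacet w ↔ cs.proj {p.2}ᶜ w = p.1 := by
  simp only [coxeterFacet, Finset.mem_map, Finset.mem_univ, true_and]
  constructor
  · rintro ⟨s, rfl⟩; rfl
  · intro h; exact ⟨p.2, Prod.ext h rfl⟩

theorem card_coxeterFacet (w : W) : (cs.coxeterFacet w).card = Fintype.card B := by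
  rw [coxeterFacet, Finset.card_map, Finset.card_univ]

theorem mem_vertices_coxeterComplex {Y : Set W} {w : W} (hw : w ∈ Y) (i : B) :
    (cs.proj {i}ᶜ w, i) ∈ (cs.coxeterComplex Y).vertices :=
  ⟨Finset.singleton_nonempty _, w, hw,
    Finset.singleton_subset_iff.2 (cs.mem_coxeterFacet.2 rfl)⟩

theorem coxeterFacet_mul_simple [DecidableEq (W × B)] (w : W) (i : B) :
    cs.coxeterFacet (w * cs.simple i) = insert (cs.proj {i}ᶜ (w * cs.simple i), i)
      ((cs.coxeterFacet w).erase (cs.proj {i}ᶜ w, i)) := by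
  ext ⟨x, j⟩
  rw [Finset.mem_insert, Finset.mem_erase, mem_coxeterFacet, mem_coxeterFacet]
  by_cases hj : j = i
  · subst hj
    simp only [Prod.mk.injEq, and_true]
    constructor
    · exact fun h => Or.inl h.symm
    · rintro (h | h)
      · exact h.symm
      · exact (h.1 (Prod.ext h.2.symm rfl)).elim
  · rw [cs.proj_mul_simple (J := {j}ᶜ) (Ne.symm hj)]
    simp [hj]

theorem facets_coxeterComplex [Nonempty B] (Y : Set W) :
    (cs.coxeterComplex Y).facets = {F | ∃ w ∈ Y, F = cs.coxeterFacet w} := by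
  have hface : ∀ w ∈ Y, cs.coxeterFacet w ∈ (cs.coxeterComplex Y).faces := fun w hw =>
    ⟨Finset.card_pos.1 (by rw [card_coxeterFacet]; exact Fintype.card_pos), w, hw, subset_rfl⟩
  ext F
  constructor
  · rintro ⟨⟨-, w, hw, hF⟩, hmax⟩
    exact ⟨w, hw, le_antisymm hF (hmax (hface w hw) hF)⟩
  · rintro ⟨w, hw, rfl⟩
    refine ⟨hface w hw, ?_⟩
    rintro G ⟨-, w', -, hG⟩ hle
    refine (Finset.eq_of_subset_of_card_le hle ?_).ge
    rw [card_coxeterFacet, ← cs.card_coxeterFacet w']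
    exact Finset.card_le_card hG

theorem isPure_coxeterComplex [Nonempty B] (Y : Set W) :
    (cs.coxeterComplex Y).IsPure (Fintype.card B - 1) := by
  intro F hF
  rw [facets_coxeterComplex] at hF
  obtain ⟨w, -, rfl⟩ := hF
  rw [card_coxeterFacet]
  have := Fintype.card_pos (α := B)
  omega

theorem finite_vertices_coxeterComplex {Y : Set W} (hY : Y.Finite) :
    (cs.coxeterComplex Y).vertices.Finite := by
  refine (hY.biUnion fun w _ => (cs.coxeterFacet w).finite_toSet).subset ?_
  rintro p ⟨-, w, hw, hp⟩
  exact Set.mem_biUnion hw (Finset.singleton_subset_iff.1 hp)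

/-- The facet `P(w)` of the Coxeter complex of `Y`, for `w ∈ Y`. -/
noncomputable def toFacet [Nonempty B] {Y : Set W} (w : W) (hw : w ∈ Y) :
    (cs.coxeterComplex Y).facets :=
  ⟨cs.coxeterFacet w, by rw [facets_coxeterComplex]; exact ⟨w, hw, rfl⟩⟩

/-- For labels that increase with the lengths of the vertices, `P` is monotone from the right weak
order to the Gale order. -/
theorem inducedMap_toFacet_mono [Nonempty B] {u v : W} {n d : ℕ}
    (hX : (cs.coxeterComplex (cs.rightWeakInterval u v)).IsPure d)
    (σ : (cs.coxeterComplex (cs.rightWeakInterval u v)).vertices ≃ Fin n)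
    (hσ : ∀ p q, cs.length p.1.1 < cs.length q.1.1 → σ p < σ q) {x y : W}
    (hx : x ∈ cs.rightWeakInterval u v) (hy : y ∈ cs.rightWeakInterval u v)
    (hyx : cs.RightWeakLE y x) :
    PreAbstractSimplicialComplex.inducedMap _ hX σ (cs.toFacet y hy) ≤
      PreAbstractSimplicialComplex.inducedMap _ hX σ (cs.toFacet x hx) := by
  classical
  induction hyx with
  | refl => exact le_rfl
  | tail hyz h ih =>
    rename_i z c
    obtain ⟨i, hi⟩ := h.2
    have hc : c = z * cs.simple i := by rw [hi, mul_inv_cancel_left]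
    subst hc
    have hz : z ∈ cs.rightWeakInterval u v :=
      ⟨RightWeakLE.trans cs hy.1 hyz, RightWeakLE.trans cs (cs.rightWeakLE_mul_simple h.1) hx.2⟩
    have hlt := cs.length_proj_lt h.1
    refine (ih hz).trans (PreAbstractSimplicialComplex.inducedMap_le_of_eq_insert_erase _ hX σ
      (p := ⟨_, cs.mem_vertices_coxeterComplex hz i⟩)
      (q := ⟨_, cs.mem_vertices_coxeterComplex hx i⟩) (cs.mem_coxeterFacet.2 rfl)
      (hσ _ _ hlt) (cs.coxeterFacet_mul_simple z i))

/-- For labels that increase with the lengths of the vertices, every linear extension of the Gale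
order on the facets is a shelling order. -/
theorem isShellingOrder_of_isLinearExtension [Nonempty B] {u v : W} {n d h : ℕ}
    (hX : (cs.coxeterComplex (cs.rightWeakInterval u v)).IsPure d)
    (σ : (cs.coxeterComplex (cs.rightWeakInterval u v)).vertices ≃ Fin n)
    (hσ : ∀ p q, cs.length p.1.1 < cs.length q.1.1 → σ p < σ q)
    (L : Set.range (PreAbstractSimplicialComplex.inducedMap _ hX σ) ≃ Fin h)
    (hL : IsLinearExtension L) : IsShellingOrder fun i => (L.symm i).1 := by
  classical
  refine ⟨Subtype.val_injective.comp L.symm.injective, fun i j hij => ?_⟩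
  have hrep : ∀ k : Fin h, ∃ (w : W) (hw : w ∈ cs.rightWeakInterval u v),
      (L.symm k).1 = PreAbstractSimplicialComplex.inducedMap _ hX σ (cs.toFacet w hw) := by
    intro k
    obtain ⟨⟨F, hF⟩, hFk⟩ := (L.symm k).2
    obtain ⟨w, hw, rfl⟩ := (cs.facets_coxeterComplex _).subset hF
    exact ⟨w, hw, hFk.symm⟩
  have hmono : ∀ k l : Fin h, (L.symm k).1 ≤ (L.symm l).1 → k ≤ l := by
    intro k l hkl
    rcases hkl.eq_or_lt with heq | hlt
    · exact (L.symm.injective (Subtype.ext heq)).le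
    · simpa using (hL (L.symm k) (L.symm l) hlt).le
  obtain ⟨x, hx, hxi⟩ := hrep i
  obtain ⟨y, hy, hyj⟩ := hrep j
  have hyx : ¬ cs.RightWeakLE y x := fun hle =>
    hij.not_ge (hmono j i (by rw [hxi, hyj]; exact cs.inducedMap_toFacet_mono hX σ hσ hx hy hle))
  obtain ⟨s, hlt, hys, hne⟩ := cs.exists_mul_simple_proj_ne hx hy hyx
  have hlt' : cs.length (y * cs.simple s) < cs.length (y * cs.simple s * cs.simple s) := by
    rwa [cs.simple_mul_simple_cancel_right]
  have hproj := cs.length_proj_lt hlt'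
  rw [cs.simple_mul_simple_cancel_right] at hproj
  have hle := cs.rightWeakLE_mul_simple hlt'
  rw [cs.simple_mul_simple_cancel_right] at hle
  set a : (cs.coxeterComplex (cs.rightWeakInterval u v)).vertices :=
    ⟨_, cs.mem_vertices_coxeterComplex hy s⟩
  set b : (cs.coxeterComplex (cs.rightWeakInterval u v)).vertices :=
    ⟨_, cs.mem_vertices_coxeterComplex hys s⟩
  have hlab := PreAbstractSimplicialComplex.labels_eq_insert_erase _ σ
    (F := cs.toFacet y hy) (G := cs.toFacet _ hys) (p := a) (q := b)
    (cs.coxeterFacet_mul_simple y s)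
  have hay : σ a ∈ PreAbstractSimplicialComplex.labels _ σ (cs.toFacet y hy) :=
    (PreAbstractSimplicialComplex.mem_labels _).2 (by
      rw [Equiv.symm_apply_apply]; exact cs.mem_coxeterFacet.2 rfl)
  have hax : σ a ∉ PreAbstractSimplicialComplex.labels _ σ (cs.toFacet x hx) := fun hmem => by
    have := (PreAbstractSimplicialComplex.mem_labels _).1 hmem
    rw [Equiv.symm_apply_apply] at this
    exact hne (cs.mem_coxeterFacet.1 this).symm
  have hby : σ b ∉ PreAbstractSimplicialComplex.labels _ σ (cs.toFacet y hy) := fun hmem => by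
    have := (PreAbstractSimplicialComplex.mem_labels _).1 hmem
    rw [Equiv.symm_apply_apply] at this
    exact hproj.ne' (congrArg cs.length (cs.mem_coxeterFacet.1 this))
  set r : Fin h := L ⟨_, Set.mem_range_self (cs.toFacet _ hys)⟩ with hr
  have hrr : (L.symm r).1 =
      PreAbstractSimplicialComplex.inducedMap _ hX σ (cs.toFacet _ hys) := by
    rw [hr, Equiv.symm_apply_apply]
  have hset : ∀ {k : Fin h} {w : W} {hw : w ∈ cs.rightWeakInterval u v},
      (L.symm k).1 = PreAbstractSimplicialComplex.inducedMap _ hX σ (cs.toFacet w hw) →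
      (L.symm k).1.toSet = PreAbstractSimplicialComplex.labels _ σ (cs.toFacet w hw) := by
    intro k w hw hk
    rw [hk, PreAbstractSimplicialComplex.toSet_inducedMap]
  have hbr : σ b ∈ PreAbstractSimplicialComplex.labels _ σ (cs.toFacet _ hys) :=
    hlab ▸ Finset.mem_insert_self _ _
  have hrj : r ≤ j := hmono r j (by
    rw [hrr, hyj]; exact cs.inducedMap_toFacet_mono hX σ hσ hy hys hle)
  refine ⟨r, hrj.lt_of_ne ?_, σ a, ?_, σ b, ?_, ?_⟩
  · intro heq
    have h1 := hset hrr
    rw [heq, hset hyj, Finset.coe_inj] at h1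
    exact hby (h1 ▸ hbr)
  · rw [hset hyj, hset hxi]; exact ⟨hay, hax⟩
  · rw [hset hyj, hset hrr]; exact ⟨hbr, hby⟩
  · rw [hset hyj, hset hrr, hlab]
    ext c
    simp only [Finset.coe_insert, Finset.coe_erase, Set.mem_insert_iff, Set.mem_sdiff,
      Finset.mem_coe, Set.mem_singleton_iff, Set.mem_symmDiff]
    have hab : σ a ≠ σ b := fun h => hby (h ▸ hay)
    by_cases hca : c = σ a
    · subst hca; simp [hab, hay]
    · by_cases hcb : c = σ b
      · subst hcb; simp [hby]
      · simp [hca, hcb]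

end CoxeterSystem

theorem mainTheorem2 {B W : Type*} [Fintype B] [Nonempty B] [Group W] {M : CoxeterMatrix B}
    (cs : CoxeterSystem M W) (u v : W) (huv : cs.RightWeakLE u v) :
    (cs.coxeterComplex (cs.rightWeakInterval u v)).facets =
        {F | ∃ w ∈ cs.rightWeakInterval u v, F = cs.coxeterFacet w} ∧
      (cs.coxeterComplex (cs.rightWeakInterval u v)).IsPure (Fintype.card B - 1) ∧
      (cs.coxeterComplex (cs.rightWeakInterval u v)).LinearlyShellable := by
  refine ⟨cs.facets_coxeterComplex _, cs.isPure_coxeterComplex _, ?_⟩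
  have hfin := cs.finite_vertices_coxeterComplex (cs.finite_rightWeakInterval u v)
  have : Finite (cs.coxeterComplex (cs.rightWeakInterval u v)).vertices := hfin
  have hu : u ∈ cs.rightWeakInterval u v := ⟨Relation.ReflTransGen.refl, huv⟩
  have : Nonempty (cs.coxeterComplex (cs.rightWeakInterval u v)).vertices :=
    ⟨⟨_, cs.mem_vertices_coxeterComplex hu (Classical.arbitrary B)⟩⟩
  obtain ⟨σ, hσ⟩ := exists_equiv_fin_lt_of_lt
    fun p : (cs.coxeterComplex (cs.rightWeakInterval u v)).vertices => cs.length p.1.1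
  obtain ⟨L, hL⟩ := exists_isLinearExtension (Set.range
    (PreAbstractSimplicialComplex.inducedMap _ (cs.isPure_coxeterComplex _) σ))
  exact ⟨_, _, Nat.card_pos.ne', cs.isPure_coxeterComplex _, σ, _, L, hL,
    cs.isShellingOrder_of_isLinearExtension _ σ hσ L hL⟩
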